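/- Let $m,s,n\ge 1$ and $K\ge 0$ be integers, let $(x_j,y_j)\in\mathbb{R}^m\times\mathbb{R}^s$ $(j=1,\dots,n)$ be observed input--output vectors with $x_j\ge 0$, $x_j\ne 0$, $y_j\ge 0$, $y_j\neq 0$, and let $(r^-_t,r^+_t)\in\mathbb{R}^m\times\mathbb{R}^s$ $(t=1,\dots,K)$ be arbitrary trade-off directions. (Vector inequalities $\le,\ge$ are componentwise, and $>$ between vectors means strict inequality in every component.) Let $$P=\Big\{(x,y)\in\mathbb{R}^m\times\mathbb{R}^s \;\Big|\; \exists \lambda\in\mathbb{R}^n,\ \pi\in\mathbb{R}^K:\ \sum_{j}\lambda_jx_j+\sum_t\pi_t r^-_t\le x,\ \sum_{j}\lambda_jy_j+\sum_t\pi_t r^+_t\ge y,\ \sum_j\lambda_j=1,\ \lambda\ge 0,\ \pi\ge 0\Big\}$$ and let $T=\{(x,y)\in P\mid x\ge 0,\ y\ge 0,\ y\ne 0\}$ (the production possibility set $T_{\mathrm{VRS\text{-}TO}}$). For a set $S\subseteq\mathbb{R}^m\times\mathbb{R}^s$ let $$\partial^s(S)=\{(x,y)\in S\mid (x',y')\notin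 S \text{ whenever } (x,-y)\ge(x',-y'),\ (x,-y)\neq(x',-y')\},$$ $$\partial^w(S)=\{(x,y)\in S\mid (x',y')\notin S \text{ whenever } (x,-y)>(x',-y')\}.$$ For $(x,y)\in T$ define the extended max Russell graph measure $$\hat F(x,y;T)=\max\Big\{\frac{1}{m+s}\Big(\sum_{i=1}^m\theta_i+\sum_{r=1}^s\frac1{\phi_r}\Big)\;\Big|\; \big((\theta_ix_i)_i,(\phi_ry_r)_r\big)\in\partial^s(T),\ 0\le\theta_i\le 1\ (i=1,\dots,m),\ \phi_r\ge 1\ (r=1,\dots,s)\Big\}.$$ Assume that $P\neq\mathbb{R}^m\times\mathbb{R}^s$ and $\partial^s(P)=\partial^w(P)$. Then the maximum defining $\hat F(x,y;T)$ exists for every $(x,y)\in T$ (including points with some zero inputs or outputs), and $\hat F$ has the following two properties. (I) Indication of efficiency: for all $(x,y)\in T$, $\hat F(x,y;T)=1$ if and only if $(x,y)\in\partial^s(T)$. (SM) Strong monotonicity: for all $(x,y),(x',y')\in T$ with $(x,-y)\le(x',-y')$ and $(x,-y)\neq(x',-y')$, one has $\hat F(x,y;T)>\hat F(x',y';T)$.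 -/

import Mathlib

/-- Input--output vectors `(x, y)` with `m` inputs and `s` outputs. -/
abbrev IOVec (m s : ℕ) : Type := (Fin m → ℝ) × (Fin s → ℝ)

/-- The trade-offs polyhedron `P` generated by the observed units `(xd j, yd j)`, `j = 1, …, n`,
and the trade-off directions `(rin t, rout t)`, `t = 1, …, K`.
Vector inequalities are componentwise. -/
def tradeOffPolyhedron {m s n K : ℕ}
    (xd : Fin n → Fin m → ℝ) (yd : Fin n → Fin s → ℝ)
    (rin : Fin K → Fin m → ℝ) (rout : Fin K → Fin s → ℝ) : Set (IOVec m s) :=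
  {p | ∃ (lam : Fin n → ℝ) (mu : Fin K → ℝ),
    (∑ j, lam j • xd j + ∑ t, mu t • rin t ≤ p.1) ∧
    (p.2 ≤ ∑ j, lam j • yd j + ∑ t, mu t • rout t) ∧
    ∑ j, lam j = 1 ∧ (∀ j, 0 ≤ lam j) ∧ (∀ t, 0 ≤ mu t)}

/-- The production possibility set with variable returns to scale and production trade-offs:
the points of `P` with nonnegative inputs and nonnegative, nonzero outputs. -/
def productionSet {m s n K : ℕ}
    (xd : Fin n → Fin m → ℝ) (yd : Fin n → Fin s → ℝ)
    (rin : Fin K → Fin m → ℝ) (rout : Fin K → Fin s → ℝ) : Set (IOVec m s) :=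
  tradeOffPolyhedron xd yd rin rout ∩ {p | 0 ≤ p.1 ∧ 0 ≤ p.2 ∧ p.2 ≠ 0}

/-- `q` dominates `p`: no more of any input, no less of any output, and `q ≠ p`. -/
def Dominates {m s : ℕ} (q p : IOVec m s) : Prop :=
  q.1 ≤ p.1 ∧ p.2 ≤ q.2 ∧ q ≠ p

/-- `q` dominates `p` strictly in every input and every output. -/
def StrictlyDominates {m s : ℕ} (q p : IOVec m s) : Prop :=
  (∀ i, q.1 i < p.1 i) ∧ (∀ r, p.2 r < q.2 r)

/-- The strongly efficient frontier of `T`. -/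
def strongFrontier {m s : ℕ} (T : Set (IOVec m s)) : Set (IOVec m s) :=
  {p | p ∈ T ∧ ∀ q, Dominates q p → q ∉ T}

/-- The weakly efficient frontier of `T`. -/
def weakFrontier {m s : ℕ} (T : Set (IOVec m s)) : Set (IOVec m s) :=
  {p | p ∈ T ∧ ∀ q, StrictlyDominates q p → q ∉ T}

/-- The Russell objective `f (θ, φ) = (∑ θ_i + ∑ 1 / φ_r) / (m + s)`. -/
noncomputable def russellObjective {m s : ℕ} (θ : Fin m → ℝ) (φ : Fin s → ℝ) : ℝ :=
  (1 / ((m : ℝ) + (s : ℝ))) * (∑ i, θ i + ∑ r, 1 / φ r)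

/-- The objective values attained by the feasible `(θ, φ)` of the maximization problem at `p`:
`0 ≤ θ ≤ 1`, `φ ≥ 1`, and the rescaled point `(θ_i x_i, φ_r y_r)` is strongly efficient. -/
def maxRGMValues {m s : ℕ} (T : Set (IOVec m s)) (p : IOVec m s) : Set ℝ :=
  {c | ∃ (θ : Fin m → ℝ) (φ : Fin s → ℝ),
    (∀ i, 0 ≤ θ i ∧ θ i ≤ 1) ∧ (∀ r, 1 ≤ φ r) ∧
    ((fun i => θ i * p.1 i, fun r => φ r * p.2 r) : IOVec m s) ∈ strongFrontier T ∧
    c = russellObjective θ φ}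

/-- The extended max Russell graph measure: the optimal value of the maximization problem. -/
noncomputable def maxRGM {m s : ℕ} (T : Set (IOVec m s)) (p : IOVec m s) : ℝ :=
  sSup (maxRGMValues T p)

/-- Indication of efficiency (I) of a measure `F` on `T`. -/
def Indication {m s : ℕ} (T : Set (IOVec m s)) (F : IOVec m s → ℝ) : Prop :=
  ∀ p ∈ T, F p = 1 ↔ p ∈ strongFrontier T

/-- Strong monotonicity (SM) of a measure `F` on `T`. -/
def StrongMonotonicity {m s : ℕ} (T : Set (IOVec m s)) (F : IOVec m s → ℝ) : Prop :=
  ∀ p ∈ T, ∀ q ∈ T, Dominates q p → F p < F q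

/-!
A segment leaving a closed, freely disposable technology `S` does so through its weak frontier,
hence through its strong frontier when weakly efficient points are strongly efficient.

Strong monotonicity: let `v = (θ, φ)` be optimal at `p` and let `q` dominate `p`. No `θ i` vanishes,
since setting it to zero costs more than reaching the frontier by expanding a single output. So
`v * q` dominates the strongly efficient point `v * p` and lies outside `S`. The segment from `q` to
`v * q` therefore leaves `S` at some `w * q` with `w ≠ v` between `1` and `v`, and the objective is
larger at `w` than at `v`.

The maximum exists because the feasible `φ` may be truncated as soon as outputs are bounded. For a
convex `S` they are: a recession direction dominating `0` would leave no strongly efficient point.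
-/

open Set Topology

section ConicHull

variable {ι 𝕜 E : Type*} [Field 𝕜] [LinearOrder 𝕜] [IsStrictOrderedRing 𝕜] [AddCommGroup E]
  [Module 𝕜 E] {v : ι → E} {s : Finset ι} {x : E}

lemma mem_hull_image_finset_iff :
    x ∈ PointedCone.hull 𝕜 (v '' s) ↔ ∃ c : ι → 𝕜, (∀ i ∈ s, 0 ≤ c i) ∧ ∑ i ∈ s, c i • v i = x := by
  constructor
  · rw [Submodule.mem_span_image_finset_iff_exists_fun']
    rintro ⟨c, rfl⟩
    exact ⟨fun i => c i, fun i _ => (c i).2, rfl⟩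
  · rintro ⟨c, hc, rfl⟩
    exact sum_mem fun i hi =>
      PointedCone.smul_mem _ (hc i hi) (PointedCone.subset_hull (mem_image_of_mem v hi))

-- Move the coefficients along a linear relation until the first of them vanishes.
lemma exists_mem_hull_image_erase [DecidableEq ι] (hs : ¬LinearIndepOn 𝕜 v s)
    (hx : x ∈ PointedCone.hull 𝕜 (v '' s)) :
    ∃ i ∈ s, x ∈ PointedCone.hull 𝕜 (v '' (s.erase i)) := by
  obtain ⟨c, hc, rfl⟩ := mem_hull_image_finset_iff.1 hx
  obtain ⟨g, hg, k, hk, hgk⟩ : ∃ g : ι → 𝕜, ∑ i ∈ s, g i • v i = 0 ∧ ∃ k ∈ s, 0 < g k := by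
    obtain ⟨g, hg, k, hk, hgk⟩ := not_linearIndepOn_finset_iff.1 hs
    rcases hgk.lt_or_gt with hneg | hpos
    · exact ⟨-g, by simp [hg], k, hk, by simpa using hneg⟩
    · exact ⟨g, hg, k, hk, hpos⟩
  obtain ⟨i, hi, hmin⟩ := {j ∈ s | 0 < g j}.exists_min_image (fun j => c j / g j)
    ⟨k, Finset.mem_filter.2 ⟨hk, hgk⟩⟩
  simp only [Finset.mem_filter] at hi hmin
  obtain ⟨his, hgi⟩ := hi
  refine ⟨i, his, mem_hull_image_finset_iff.2 ⟨fun j => c j - c i / g i * g j, fun j hj => ?_, ?_⟩⟩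
  · have hjs := Finset.mem_of_mem_erase hj
    rw [sub_nonneg]
    rcases le_or_gt (g j) 0 with hgj | hgj
    · exact (mul_nonpos_of_nonneg_of_nonpos (div_nonneg (hc i his) hgi.le) hgj).trans (hc j hjs)
    · exact (le_div_iff₀ hgj).1 (hmin j ⟨hjs, hgj⟩)
  · rw [Finset.sum_erase s (by simp [hgi.ne'])]
    simp only [sub_smul, mul_smul, Finset.sum_sub_distrib, ← Finset.smul_sum, hg, smul_zero,
      sub_zero]

lemma exists_linearIndepOn_mem_hull_image (hx : x ∈ PointedCone.hull 𝕜 (v '' s)) :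
    ∃ t ⊆ s, LinearIndepOn 𝕜 v t ∧ x ∈ PointedCone.hull 𝕜 (v '' t) := by
  classical
  induction s using Finset.strongInduction with
  | H s ih =>
    by_cases hs : LinearIndepOn 𝕜 v s
    · exact ⟨s, subset_rfl, hs, hx⟩
    · obtain ⟨i, hi, hxi⟩ := exists_mem_hull_image_erase hs hx
      obtain ⟨t, hts, ht⟩ := ih _ (Finset.erase_ssubset hi) hxi
      exact ⟨t, hts.trans (s.erase_subset i), ht⟩

end ConicHull

section ClosedCone

variable {ι E : Type*} [AddCommGroup E] [Module ℝ E] [TopologicalSpace E]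
  [IsTopologicalAddGroup E] [ContinuousSMul ℝ E] [T2Space E] {v : ι → E}

lemma isClosed_hull_image_of_linearIndepOn {s : Finset ι} (hs : LinearIndepOn ℝ v s) :
    IsClosed (PointedCone.hull ℝ (v '' s) : Set E) := by
  have himage : (PointedCone.hull ℝ (v '' s) : Set E) =
      Fintype.linearCombination ℝ (fun i : s => v i) '' Ici 0 := by
    ext x
    rw [SetLike.mem_coe, image_eq_range, Submodule.mem_span_range_iff_exists_fun]
    constructor
    · rintro ⟨c, rfl⟩
      exact ⟨fun i => c i, fun i => (c i).2, rfl⟩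
    · rintro ⟨c, hc, rfl⟩
      exact ⟨fun i => ⟨c i, hc i⟩, rfl⟩
  rw [himage]
  refine (LinearMap.isClosedEmbedding_of_injective ?_).isClosedMap _ isClosed_Ici
  exact LinearMap.ker_eq_bot.2 (linearIndependent_iff_injective_fintypeLinearCombination.1 hs)

lemma isClosed_hull_range [Finite ι] (v : ι → E) :
    IsClosed (PointedCone.hull ℝ (range v) : Set E) := by
  cases nonempty_fintype ι
  have hunion : (PointedCone.hull ℝ (range v) : Set E) =
      ⋃ t ∈ {t : Finset ι | LinearIndepOn ℝ v t}, PointedCone.hull ℝ (v '' t) := by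
    refine subset_antisymm (fun x hx => ?_)
      (iUnion₂_subset fun t _ => Submodule.span_mono (image_subset_range v t))
    have hx' : x ∈ PointedCone.hull ℝ (v '' (Finset.univ : Finset ι)) := by simpa using hx
    obtain ⟨t, -, ht, hxt⟩ := exists_linearIndepOn_mem_hull_image hx'
    exact mem_biUnion ht hxt
  rw [hunion]
  exact (toFinite _).isClosed_biUnion fun t ht => isClosed_hull_image_of_linearIndepOn ht

end ClosedCone

section Technology

variable {m s : ℕ} {S : Set (IOVec m s)}

/-- Free disposability of a technology: inputs may be wasted and outputs discarded. -/
def FreelyDisposable (S : Set (IOVec m s)) : Prop :=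
  ∀ p ∈ S, ∀ q : IOVec m s, p.1 ≤ q.1 → q.2 ≤ p.2 → q ∈ S

/-- Boundedness of the output sets of a technology: a given input vector produces only bounded
nonnegative outputs. The bound is a vector, since the order is componentwise. -/
def HasBoundedOutputs (S : Set (IOVec m s)) : Prop :=
  ∀ x, BddAbove {y | 0 ≤ y ∧ (x, y) ∈ S}

/-- The economically meaningful points: nonnegative inputs and nonnegative, nonzero outputs. -/
def ioOrthant (m s : ℕ) : Set (IOVec m s) := {p | 0 ≤ p.1 ∧ 0 ≤ p.2 ∧ p.2 ≠ 0}

lemma isOpen_setOf_strictlyDominates (q : IOVec m s) : IsOpen {p | StrictlyDominates q p} := by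
  simp only [StrictlyDominates, ofPred_and, ofPred_forall]
  exact (isOpen_iInter_of_finite fun i => isOpen_lt continuous_const (by fun_prop)).inter
    (isOpen_iInter_of_finite fun r => isOpen_lt (by fun_prop) continuous_const)

lemma isClosed_weakFrontier (hS : IsClosed S) : IsClosed (weakFrontier S) := by
  have hweak : weakFrontier S = S ∩ ⋂ q ∈ S, {p | StrictlyDominates q p}ᶜ := by
    ext p
    simp only [weakFrontier, mem_ofPred_eq, mem_inter_iff, mem_iInter, mem_compl_iff, imp_not_comm]
  rw [hweak]
  exact hS.inter
    (isClosed_biInter fun q _ => (isOpen_setOf_strictlyDominates q).isClosed_compl)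

lemma exists_lineMap_mem_weakFrontier (hS : IsClosed S) (hfd : FreelyDisposable S)
    {p w : IOVec m s} (hp : p ∈ S) (hw : w ∉ S) :
    ∃ t ∈ Ico (0 : ℝ) 1, AffineMap.lineMap p w t ∈ weakFrontier S := by
  have hcont : Continuous (AffineMap.lineMap p w : ℝ → IOVec m s) :=
    AffineMap.lineMap_continuous
  obtain ⟨t, ⟨⟨ht₀, ht₁⟩, htS⟩, hmax⟩ :=
    (isCompact_Icc.inter_right (hS.preimage hcont)).exists_isGreatest
      (s := Icc (0 : ℝ) 1 ∩ AffineMap.lineMap p w ⁻¹' S)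
      ⟨0, left_mem_Icc.2 zero_le_one, by simpa using hp⟩
  have ht : t < 1 := ht₁.lt_of_ne fun h => hw (by simpa [h] using htS)
  refine ⟨t, ⟨ht₀, ht⟩, htS, fun q hq hqS => ?_⟩
  have hnear : ∀ᶠ u in 𝓝[>] t, StrictlyDominates q (AffineMap.lineMap p w u) :=
    (hcont.continuousAt.eventually
      ((isOpen_setOf_strictlyDominates q).mem_nhds hq)).filter_mono nhdsWithin_le_nhds
  obtain ⟨u, hqu, htu, hu⟩ := (hnear.and (Ioo_mem_nhdsGT ht)).exists
  exact htu.not_ge (hmax ⟨⟨ht₀.trans htu.le, hu.le⟩,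
    hfd q hqS _ (fun i => (hqu.1 i).le) fun r => (hqu.2 r).le⟩)

lemma mem_strongFrontier_inter_ioOrthant_iff (hfd : FreelyDisposable S)
    (hws : weakFrontier S ⊆ strongFrontier S) {p : IOVec m s} :
    p ∈ strongFrontier (S ∩ ioOrthant m s) ↔ p ∈ weakFrontier S ∧ p ∈ ioOrthant m s := by
  constructor
  · rintro ⟨⟨hpS, hp⟩, hdom⟩
    refine ⟨⟨hpS, fun q hq hqS => ?_⟩, hp⟩
    obtain ⟨r, -⟩ := Function.ne_iff.1 hp.2.2
    have hle : p.2 ≤ q.2 := fun r => (hq.2 r).le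
    have hne : q.2 ≠ p.2 := fun h => (hq.2 r).ne' (congrFun h r)
    have hpos : q.2 ≠ 0 := fun h => ((hp.2.1 r).trans_lt (hq.2 r)).ne' (congrFun h r)
    -- `q` itself may have negative inputs
    exact hdom (p.1, q.2) ⟨le_rfl, hle, fun h => hne (Prod.ext_iff.1 h).2⟩
      ⟨hfd q hqS _ (fun i => (hq.1 i).le) le_rfl, hp.1, hp.2.1.trans hle, hpos⟩
  · rintro ⟨hw, hp⟩
    exact ⟨⟨hw.1, hp⟩, fun q hq hqT => (hws hw).2 q hq hqT.1⟩

lemma not_dominates_zero_of_mem_asymptoticCone (hS : IsClosed S) (hconv : Convex ℝ S)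
    (hfd : FreelyDisposable S) (huniv : S ≠ univ) (hws : weakFrontier S ⊆ strongFrontier S)
    {d : IOVec m s} (hd : d ∈ asymptoticCone ℝ S) : ¬Dominates d 0 := by
  rintro ⟨hin, hout, hne⟩
  obtain ⟨p, hp⟩ := asymptoticCone_nonempty.1 ⟨d, hd⟩
  obtain ⟨w, hw⟩ := (ne_univ_iff_exists_notMem S).1 huniv
  obtain ⟨t, -, ht⟩ := exists_lineMap_mem_weakFrontier hS hfd hp hw
  have hmem := hconv.smul_vadd_mem_of_isClosed_of_mem_asymptoticCone hS zero_le_one hd ht.1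
  rw [one_smul, vadd_eq_add] at hmem
  exact (hws ht).2 _
    ⟨add_le_of_nonpos_left hin, le_add_of_nonneg_left hout, by simpa using hne⟩ hmem

lemma hasBoundedOutputs_of_convex (hS : IsClosed S) (hconv : Convex ℝ S)
    (hfd : FreelyDisposable S) (huniv : S ≠ univ) (hws : weakFrontier S ⊆ strongFrontier S) :
    HasBoundedOutputs S := by
  intro x
  let A : Set (IOVec m s) := S ∩ {x} ×ˢ Ici 0
  have hA : IsClosed A := hS.inter (isClosed_singleton.prod isClosed_Ici)
  have hAconv : Convex ℝ A := hconv.inter ((convex_singleton x).prod (convex_Ici 0))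
  suffices hbdd : Bornology.IsBounded A by
    refine hbdd.image_snd.bddAbove.mono ?_
    rintro y ⟨hy, hxy⟩
    exact ⟨(x, y), ⟨hxy, rfl, hy⟩, rfl⟩
  rw [isBounded_iff_asymptoticCone_subset_singleton]
  intro d hd
  obtain ⟨a, ha⟩ := asymptoticCone_nonempty.1 ⟨d, hd⟩
  have hray : ∀ c : ℝ, 0 ≤ c → c • d + a ∈ A := fun c hc =>
    hAconv.smul_vadd_mem_of_isClosed_of_mem_asymptoticCone hA hc hd ha
  have hin : d.1 = 0 := by
    have h : (1 : ℝ) • d.1 + a.1 = x := (hray 1 zero_le_one).2.1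
    have ha₁ : a.1 = x := ha.2.1
    simpa [ha₁] using h
  have hout : 0 ≤ d.2 := by
    intro r
    by_contra! hneg
    have hneg : d.2 r < 0 := hneg
    have hr : 0 ≤ a.2 r := ha.2.2 r
    have h : 0 ≤ (a.2 r + 1) / -d.2 r * d.2 r + a.2 r :=
      (hray _ (div_nonneg (by linarith) (by linarith))).2.2 r
    rw [div_neg, neg_mul, div_mul_cancel₀ _ hneg.ne] at h
    linarith
  by_contra hd₀
  exact not_dominates_zero_of_mem_asymptoticCone hS hconv hfd huniv hws
    (asymptoticCone_mono inter_subset_left hd) ⟨hin.le, hout, hd₀⟩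

end Technology

section TradeOffPolyhedron

variable {m s n K : ℕ} (xd : Fin n → Fin m → ℝ) (yd : Fin n → Fin s → ℝ)
  (rin : Fin K → Fin m → ℝ) (rout : Fin K → Fin s → ℝ)

/-- The directions along which the trade-offs polyhedron recedes: the trade-offs and, encoding the
slacks in its defining inequalities, the unit increase of an input and decrease of an output. -/
def recessionGenerator : Fin K ⊕ Fin m ⊕ Fin s → IOVec m s :=
  Sum.elim (fun t => (rin t, rout t))
    (Sum.elim (fun i => (Pi.single i 1, 0)) (fun r => (0, -Pi.single r 1)))

lemma sum_smul_recessionGenerator (c : Fin K ⊕ Fin m ⊕ Fin s → ℝ) :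
    ∑ g, c g • recessionGenerator rin rout g =
      (∑ t, c (.inl t) • rin t + fun i => c (.inr (.inl i)),
        ∑ t, c (.inl t) • rout t - fun r => c (.inr (.inr r))) := by
  ext j <;> simp [recessionGenerator, Prod.fst_sum, Prod.snd_sum, Pi.single_apply, sub_eq_add_neg]

lemma mem_hull_recessionGenerator_iff {d : IOVec m s} :
    d ∈ PointedCone.hull ℝ (range (recessionGenerator rin rout)) ↔
      ∃ mu : Fin K → ℝ, 0 ≤ mu ∧ ∑ t, mu t • rin t ≤ d.1 ∧ d.2 ≤ ∑ t, mu t • rout t := by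
  simp only [← image_univ, ← Finset.coe_univ, mem_hull_image_finset_iff,
    sum_smul_recessionGenerator, Finset.mem_univ, true_imp_iff]
  constructor
  · rintro ⟨c, hc, rfl⟩
    exact ⟨fun t => c (.inl t), fun t => hc _, le_add_of_nonneg_right fun i => hc _,
      sub_le_self _ fun r => hc _⟩
  · rintro ⟨mu, hmu, hin, hout⟩
    refine ⟨Sum.elim mu (Sum.elim (d.1 - ∑ t, mu t • rin t) (∑ t, mu t • rout t - d.2)), ?_, ?_⟩
    · rintro (t | i | r)
      exacts [hmu t, sub_nonneg.2 (hin i), sub_nonneg.2 (hout r)]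
    · exact Prod.ext (add_sub_cancel _ d.1) (sub_sub_cancel _ d.2)

lemma linearCombination_prodMk {ι R M N : Type*} [Fintype ι] [Semiring R] [AddCommMonoid M]
    [AddCommMonoid N] [Module R M] [Module R N] (v : ι → M) (w : ι → N) (c : ι → R) :
    Fintype.linearCombination R (fun j => (v j, w j)) c = (∑ j, c j • v j, ∑ j, c j • w j) := by
  ext <;> simp [Fintype.linearCombination_apply, Prod.fst_sum, Prod.snd_sum]

open Pointwise in
lemma tradeOffPolyhedron_eq_image_add_hull :
    tradeOffPolyhedron xd yd rin rout =
      Fintype.linearCombination ℝ (fun j => ((xd j, yd j) : IOVec m s)) '' stdSimplex ℝ (Fin n) +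
        (PointedCone.hull ℝ (range (recessionGenerator rin rout)) : Set (IOVec m s)) := by
  ext p
  constructor
  · rintro ⟨lam, mu, hin, hout, hsum, hlam, hmu⟩
    refine ⟨_, ⟨lam, ⟨hlam, hsum⟩, linearCombination_prodMk xd yd lam⟩, _,
      (mem_hull_recessionGenerator_iff rin rout).2 ⟨mu, hmu, ?_, ?_⟩, add_sub_cancel _ p⟩
    · exact le_sub_iff_add_le'.2 hin
    · exact sub_le_iff_le_add'.2 hout
  · rintro ⟨_, ⟨lam, ⟨hlam, hsum⟩, rfl⟩, d, hd, rfl⟩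
    obtain ⟨mu, hmu, hin, hout⟩ := (mem_hull_recessionGenerator_iff rin rout).1 hd
    rw [linearCombination_prodMk]
    exact ⟨lam, mu, add_le_add_right hin _, add_le_add_right hout _, hsum, hlam, hmu⟩

lemma isClosed_tradeOffPolyhedron : IsClosed (tradeOffPolyhedron xd yd rin rout) := by
  rw [tradeOffPolyhedron_eq_image_add_hull]
  exact (isClosed_hull_range _).add_left_of_isCompact
    ((isCompact_stdSimplex ℝ _).image (LinearMap.continuous_of_finiteDimensional _))

lemma convex_tradeOffPolyhedron : Convex ℝ (tradeOffPolyhedron xd yd rin rout) := by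
  rw [tradeOffPolyhedron_eq_image_add_hull]
  exact ((convex_stdSimplex ℝ _).linear_image _).add (PointedCone.convex _)

lemma freelyDisposable_tradeOffPolyhedron :
    FreelyDisposable (tradeOffPolyhedron xd yd rin rout) := by
  rintro p ⟨lam, mu, hin, hout, hmem⟩ q hpq hqp
  exact ⟨lam, mu, hin.trans hpq, hqp.trans hout, hmem⟩

lemma hasBoundedOutputs_tradeOffPolyhedron
    (hproper : tradeOffPolyhedron xd yd rin rout ≠ univ)
    (hws : weakFrontier (tradeOffPolyhedron xd yd rin rout) ⊆
      strongFrontier (tradeOffPolyhedron xd yd rin rout)) :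
    HasBoundedOutputs (tradeOffPolyhedron xd yd rin rout) :=
  hasBoundedOutputs_of_convex (isClosed_tradeOffPolyhedron xd yd rin rout)
    (convex_tradeOffPolyhedron xd yd rin rout) (freelyDisposable_tradeOffPolyhedron xd yd rin rout)
    hproper hws

end TradeOffPolyhedron

section RussellObjective

variable {m s : ℕ}

/-- The rescalings admitted by the Russell measures: pairs `v = (θ, φ)` contracting inputs and
expanding outputs. They act on input--output vectors by componentwise multiplication `v * p`. -/
def rescalings (m s : ℕ) : Set (IOVec m s) := Icc 0 1 ×ˢ Ici 1

lemma convex_rescalings : Convex ℝ (rescalings m s) :=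
  (convex_Icc 0 1).prod (convex_Ici 1)

lemma one_mem_rescalings : (1 : IOVec m s) ∈ rescalings m s :=
  ⟨⟨zero_le_one, le_rfl⟩, self_mem_Ici⟩

lemma russellObjective_lt_of_dominates {v w : IOVec m s} (h : Dominates v w)
    (hw : ∀ r, 0 < w.2 r) : russellObjective v.1 v.2 < russellObjective w.1 w.2 := by
  obtain ⟨hθ, hφ, hne⟩ := h
  have hcard : 0 < (m : ℝ) + s := by
    rcases (m + s).eq_zero_or_pos with h₀ | hpos
    · obtain ⟨rfl, rfl⟩ := Nat.add_eq_zero_iff.1 h₀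
      exact absurd (Subsingleton.elim v w) hne
    · exact_mod_cast hpos
  have hinv : (fun r => 1 / v.2 r) ≤ fun r => 1 / w.2 r :=
    fun r => one_div_le_one_div_of_le (hw r) (hφ r)
  refine mul_lt_mul_of_pos_left ?_ (one_div_pos.2 hcard)
  rcases hθ.lt_or_eq with hθlt | hθeq
  · exact add_lt_add_of_lt_of_le (Fintype.sum_strictMono hθlt) (Fintype.sum_mono hinv)
  · refine add_lt_add_of_le_of_lt (Fintype.sum_mono hθ)
      (Fintype.sum_strictMono (hinv.lt_of_ne fun heq => hne (Prod.ext hθeq ?_)))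
    ext r
    simpa using congrFun heq r

lemma russellObjective_le_of_le {θ θ' : Fin m → ℝ} {φ φ' : Fin s → ℝ} (hθ : θ ≤ θ')
    (hφ : φ' ≤ φ) (hφ' : ∀ r, 0 < φ' r) : russellObjective θ φ ≤ russellObjective θ' φ' := by
  by_cases heq : ((θ, φ) : IOVec m s) = (θ', φ')
  · obtain ⟨rfl, rfl⟩ := Prod.ext_iff.1 heq
    exact le_rfl
  · exact (russellObjective_lt_of_dominates (v := (θ, φ)) (w := (θ', φ')) ⟨hθ, hφ, heq⟩ hφ').le

lemma russellObjective_one (hs : 0 < s) :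
    russellObjective (1 : Fin m → ℝ) (1 : Fin s → ℝ) = 1 := by
  have hcard : (m : ℝ) + s ≠ 0 := by positivity
  simp [russellObjective, hcard]

lemma russellObjective_eq_one_iff (hs : 0 < s) {v : IOVec m s} (hv : v ∈ rescalings m s) :
    russellObjective v.1 v.2 = 1 ↔ v = 1 := by
  constructor
  · contrapose!
    intro hne
    rw [← russellObjective_one (m := m) hs]
    exact (russellObjective_lt_of_dominates (w := 1) ⟨hv.1.2, hv.2, hne⟩
      fun _ => one_pos).ne
  · rintro rfl
    exact russellObjective_one hs

lemma continuousOn_russellObjective :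
    ContinuousOn (fun v : IOVec m s => russellObjective v.1 v.2) {v | ∀ r, v.2 r ≠ 0} := by
  unfold russellObjective
  refine continuousOn_const.mul (ContinuousOn.add (by fun_prop) ?_)
  exact continuousOn_finsetSum _ fun r _ =>
    continuousOn_const.div (by fun_prop) fun v hv => hv r

lemma sum_update_one {ι R : Type*} [Fintype ι] [DecidableEq ι] [Ring R] (i : ι) (a : R) :
    ∑ j, Function.update (1 : ι → R) i a j = Fintype.card ι - 1 + a := by
  simp [Finset.sum_update_of_mem, ← Finset.erase_eq, Nat.cast_pred (Fintype.card_pos_iff.2 ⟨i⟩),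
    add_comm]

lemma russellObjective_update_zero_lt (i : Fin m) (r : Fin s) {a : ℝ} (ha : 0 < a) :
    russellObjective (Function.update (1 : Fin m → ℝ) i 0) (1 : Fin s → ℝ) <
      russellObjective (1 : Fin m → ℝ) (Function.update (1 : Fin s → ℝ) r a) := by
  have hm : 0 < m := i.pos
  have hinv : ∀ j, 1 / Function.update (1 : Fin s → ℝ) r a j =
      Function.update (1 : Fin s → ℝ) r (1 / a) j := by
    intro j
    rcases eq_or_ne j r with rfl | hj <;> simp [*]
  have ha' : 0 < 1 / a := one_div_pos.2 ha
  refine mul_lt_mul_of_pos_left ?_ (by positivity)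
  simp only [hinv, sum_update_one, Pi.one_apply, div_one, Finset.sum_const, Finset.card_univ,
    Fintype.card_fin, nsmul_eq_mul, mul_one]
  linarith

end RussellObjective

section MaxRGM

variable {m s : ℕ} {S : Set (IOVec m s)} {p q : IOVec m s}

/-- The rescalings taking `p` to the weak frontier of `S`: the feasible set of the maximization
problem at `p` for the technology `S`, as `mem_strongFrontier_inter_ioOrthant_iff` shows. -/
def efficientRescalings (S : Set (IOVec m s)) (p : IOVec m s) : Set (IOVec m s) :=
  {v ∈ rescalings m s | v * p ∈ weakFrontier S}

/-- The rescaling that multiplies output `r` by `a` and changes nothing else. -/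
def expandOutput (m : ℕ) {s : ℕ} (r : Fin s) (a : ℝ) : IOVec m s :=
  (1, Function.update 1 r a)

lemma mul_mem_ioOrthant {v : IOVec m s} (hv : v ∈ rescalings m s) (hp : p ∈ ioOrthant m s) :
    v * p ∈ ioOrthant m s := by
  obtain ⟨⟨hθ, -⟩, hφ⟩ := hv
  obtain ⟨hx, hy, hne⟩ := hp
  obtain ⟨r, hr⟩ := Function.ne_iff.1 hne
  have hφ₀ : (0 : Fin s → ℝ) ≤ v.2 := zero_le_one.trans hφ
  refine ⟨mul_nonneg hθ hx, mul_nonneg hφ₀ hy, Function.ne_iff.2 ⟨r, ?_⟩⟩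
  exact mul_ne_zero (zero_lt_one.trans_le (hφ r)).ne' hr

lemma lineMap_one_mul {k A : Type*} [CommRing k] [Ring A] [Algebra k A] (v p : A) (t : k) :
    AffineMap.lineMap 1 v t * p = AffineMap.lineMap p (v * p) t := by
  simp only [AffineMap.lineMap_apply_module, add_mul, smul_mul_assoc, one_mul]

lemma maxRGMValues_inter_ioOrthant (hfd : FreelyDisposable S)
    (hws : weakFrontier S ⊆ strongFrontier S) (hp : p ∈ ioOrthant m s) :
    maxRGMValues (S ∩ ioOrthant m s) p =
      (fun v => russellObjective v.1 v.2) '' efficientRescalings S p := by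
  ext c
  constructor
  · rintro ⟨θ, φ, hθ, hφ, hmem, rfl⟩
    exact ⟨(θ, φ), ⟨⟨⟨fun i => (hθ i).1, fun i => (hθ i).2⟩, hφ⟩,
      ((mem_strongFrontier_inter_ioOrthant_iff hfd hws).1 hmem).1⟩, rfl⟩
  · rintro ⟨v, ⟨hv, hmem⟩, rfl⟩
    exact ⟨v.1, v.2, fun i => ⟨hv.1.1 i, hv.1.2 i⟩, hv.2,
      (mem_strongFrontier_inter_ioOrthant_iff hfd hws).2 ⟨hmem, mul_mem_ioOrthant hv hp⟩, rfl⟩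

lemma expandOutput_mem_rescalings (r : Fin s) {a : ℝ} (ha : 1 ≤ a) :
    expandOutput m r a ∈ rescalings m s :=
  ⟨⟨zero_le_one, le_rfl⟩, le_update_iff.2 ⟨ha, fun _ _ => le_rfl⟩⟩

lemma lineMap_one_expandOutput (r : Fin s) (a t : ℝ) :
    AffineMap.lineMap 1 (expandOutput m r a) t = expandOutput m r (AffineMap.lineMap 1 a t) := by
  ext j
  · simp [expandOutput]
  · rcases eq_or_ne j r with rfl | hj <;> simp [expandOutput, AffineMap.pi_lineMap_apply, *]

lemma exists_expandOutput_mul_notMem (hb : HasBoundedOutputs S) (hp : p ∈ ioOrthant m s) :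
    ∃ (r : Fin s) (a : ℝ), 1 ≤ a ∧ expandOutput m r a * p ∉ S := by
  obtain ⟨r, hr⟩ := Function.ne_iff.1 hp.2.2
  have hpr : 0 < p.2 r := (hp.2.1 r).lt_of_ne' hr
  obtain ⟨B, hB⟩ := hb p.1
  have ha : 1 ≤ 1 ⊔ (B r + 1) / p.2 r := le_sup_left
  refine ⟨r, _, ha, fun hmem => ?_⟩
  have hout := (mul_mem_ioOrthant (expandOutput_mem_rescalings r ha) hp).2.1
  have hinput : ∀ a, expandOutput m r a * p = (p.1, (expandOutput m r a * p).2) := fun a =>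
    Prod.ext (one_mul p.1) rfl
  have hle : (1 ⊔ (B r + 1) / p.2 r) * p.2 r ≤ B r := by
    simpa [expandOutput] using hB ⟨hout, hinput _ ▸ hmem⟩ r
  exact (lt_add_one (B r)).not_ge (((div_le_iff₀ hpr).1 le_sup_right).trans hle)

lemma exists_expandOutput_mem_efficientRescalings (hS : IsClosed S) (hfd : FreelyDisposable S)
    (hb : HasBoundedOutputs S) (hp : p ∈ S ∩ ioOrthant m s) :
    ∃ (r : Fin s) (a : ℝ), 0 < a ∧ expandOutput m r a ∈ efficientRescalings S p := by
  obtain ⟨r, a, ha, hout⟩ := exists_expandOutput_mul_notMem hb hp.2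
  obtain ⟨t, ht, hmem⟩ := exists_lineMap_mem_weakFrontier hS hfd hp.1 hout
  rw [← lineMap_one_mul, lineMap_one_expandOutput] at hmem
  have hat : AffineMap.lineMap 1 a t ∈ Ici (1 : ℝ) :=
    (convex_Ici 1).lineMap_mem self_mem_Ici ha ⟨ht.1, ht.2.le⟩
  exact ⟨r, _, zero_lt_one.trans_le hat, expandOutput_mem_rescalings r hat, hmem⟩

/-- Truncating `φ` at `1 ⊔ B / p.2`, where `B` bounds the outputs, alters it only where `p.2`
vanishes, and there the rescaled point does not depend on `φ`. -/
lemma exists_bound_efficientRescalings (hfd : FreelyDisposable S) (hb : HasBoundedOutputs S)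
    (hp : p ∈ ioOrthant m s) :
    ∃ U, ∀ v ∈ efficientRescalings S p, ∃ w ∈ efficientRescalings S p,
      w.2 ≤ U ∧ russellObjective v.1 v.2 ≤ russellObjective w.1 w.2 := by
  obtain ⟨B, hB⟩ := hb p.1
  -- where `p.2 r = 0`, the junk value `B r / 0 = 0` makes this a truncation at `1`
  refine ⟨1 ⊔ B / p.2, fun v ⟨hv, hmem⟩ => ?_⟩
  have hw : (v.1, v.2 ⊓ (1 ⊔ B / p.2)) ∈ rescalings m s :=
    ⟨hv.1, le_inf (mem_Ici.1 hv.2) le_sup_left⟩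
  have hvB : v.2 * p.2 ≤ B :=
    hB ⟨(mul_mem_ioOrthant hv hp).2.1,
      hfd _ hmem.1 _ (mul_le_of_le_one_left hp.1 hv.1.2) le_rfl⟩
  have hmul : (v.1, v.2 ⊓ (1 ⊔ B / p.2)) * p = v * p := by
    refine Prod.ext rfl (funext fun r => ?_)
    change (v.2 r ⊓ (1 ⊔ B r / p.2 r)) * p.2 r = v.2 r * p.2 r
    rcases (hp.2.1 r).eq_or_lt with hr | hr
    · rw [← hr]
      simp only [Pi.zero_apply, mul_zero]
    · rw [inf_eq_left.2 (((le_div_iff₀ hr).2 (hvB r)).trans le_sup_right)]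
  exact ⟨_, ⟨hw, hmul ▸ hmem⟩, inf_le_right,
    russellObjective_le_of_le le_rfl inf_le_left fun r => zero_lt_one.trans_le (hw.2 r)⟩

lemma exists_isMaxOn_efficientRescalings (hS : IsClosed S) (hfd : FreelyDisposable S)
    (hb : HasBoundedOutputs S) (hp : p ∈ S ∩ ioOrthant m s) :
    ∃ v ∈ efficientRescalings S p,
      IsMaxOn (fun v => russellObjective v.1 v.2) (efficientRescalings S p) v := by
  obtain ⟨U, htrunc⟩ := exists_bound_efficientRescalings hfd hb hp.2
  have hcompact : IsCompact ((Icc 0 1 ×ˢ Icc 1 U) ∩ (fun v => v * p) ⁻¹' weakFrontier S) :=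
    (isCompact_Icc.prod isCompact_Icc).inter_right
      ((isClosed_weakFrontier hS).preimage (by fun_prop))
  obtain ⟨r, a, -, hra⟩ := exists_expandOutput_mem_efficientRescalings hS hfd hb hp
  obtain ⟨v₀, hv₀, hv₀U, -⟩ := htrunc _ hra
  obtain ⟨v, ⟨hv, hvS⟩, hmax⟩ := hcompact.exists_isMaxOn
    ⟨v₀, ⟨hv₀.1.1, hv₀.1.2, hv₀U⟩, hv₀.2⟩
    (continuousOn_russellObjective.mono fun w hw r => (zero_lt_one.trans_le (hw.1.2.1 r)).ne')
  refine ⟨v, ⟨⟨hv.1, hv.2.1⟩, hvS⟩, fun w hw => ?_⟩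
  obtain ⟨w', hw', hw'U, hle⟩ := htrunc w hw
  exact hle.trans (hmax ⟨⟨hw'.1.1, hw'.1.2, hw'U⟩, hw'.2⟩)

lemma isGreatest_maxRGM (hS : IsClosed S) (hfd : FreelyDisposable S)
    (hb : HasBoundedOutputs S) (hws : weakFrontier S ⊆ strongFrontier S)
    (hp : p ∈ S ∩ ioOrthant m s) :
    IsGreatest ((fun v => russellObjective v.1 v.2) '' efficientRescalings S p)
      (maxRGM (S ∩ ioOrthant m s) p) := by
  obtain ⟨v, hv, hmax⟩ := exists_isMaxOn_efficientRescalings hS hfd hb hp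
  have hgreatest : IsGreatest ((fun v => russellObjective v.1 v.2) '' efficientRescalings S p)
      (russellObjective v.1 v.2) :=
    ⟨mem_image_of_mem _ hv, forall_mem_image.2 fun _ hw => hmax hw⟩
  rwa [maxRGM, maxRGMValues_inter_ioOrthant hfd hws hp.2, hgreatest.csSup_eq]

lemma indication_maxRGM (hS : IsClosed S) (hfd : FreelyDisposable S)
    (hb : HasBoundedOutputs S) (hws : weakFrontier S ⊆ strongFrontier S) :
    Indication (S ∩ ioOrthant m s) (maxRGM (S ∩ ioOrthant m s)) := by
  intro p hp
  have hmax := isGreatest_maxRGM hS hfd hb hws hp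
  obtain ⟨r, -⟩ := Function.ne_iff.1 hp.2.2.2
  rw [mem_strongFrontier_inter_ioOrthant_iff hfd hws, and_iff_left hp.2]
  constructor
  · intro h
    obtain ⟨v, hv, hv₁⟩ := hmax.1
    obtain rfl := (russellObjective_eq_one_iff r.pos hv.1).1 (hv₁.trans h)
    simpa using hv.2
  · intro h
    have hone : (1 : IOVec m s) ∈ efficientRescalings S p :=
      ⟨one_mem_rescalings, by simpa using h⟩
    refine le_antisymm ?_ ?_
    · obtain ⟨v, hv, hv₁⟩ := hmax.1
      rw [← hv₁, ← russellObjective_one (m := m) r.pos]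
      exact russellObjective_le_of_le hv.1.1.2 hv.1.2 fun _ => one_pos
    · simpa [russellObjective_one r.pos] using hmax.2 (mem_image_of_mem _ hone)

/-- A vanishing `θ i` costs more than expanding one output to the frontier. -/
lemma pos_of_isMaxOn_efficientRescalings (hS : IsClosed S) (hfd : FreelyDisposable S)
    (hb : HasBoundedOutputs S) (hp : p ∈ S ∩ ioOrthant m s) {v : IOVec m s}
    (hv : v ∈ rescalings m s)
    (hmax : IsMaxOn (fun v => russellObjective v.1 v.2) (efficientRescalings S p) v) (i : Fin m) :
    0 < v.1 i := by
  by_contra! hi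
  obtain ⟨r, a, ha, hra⟩ := exists_expandOutput_mem_efficientRescalings hS hfd hb hp
  refine (isMaxOn_iff.1 hmax _ hra).not_gt ?_
  calc
    russellObjective v.1 v.2 ≤ russellObjective (Function.update (1 : Fin m → ℝ) i 0) 1 :=
      russellObjective_le_of_le (le_update_iff.2 ⟨hi, fun j _ => hv.1.2 j⟩) hv.2
        fun _ => one_pos
    _ < russellObjective (expandOutput m r a).1 (expandOutput m r a).2 :=
      russellObjective_update_zero_lt i r ha

lemma dominates_mul_mul {v : IOVec m s} (hv₁ : ∀ i, 0 < v.1 i) (hv₂ : ∀ r, 0 < v.2 r)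
    (h : Dominates q p) : Dominates (v * q) (v * p) := by
  refine ⟨fun i => mul_le_mul_of_nonneg_left (h.1 i) (hv₁ i).le,
    fun r => mul_le_mul_of_nonneg_left (h.2.1 r) (hv₂ r).le, fun heq => h.2.2 ?_⟩
  exact Prod.ext (funext fun i => mul_left_cancel₀ (hv₁ i).ne' (congrFun (Prod.ext_iff.1 heq).1 i))
    (funext fun r => mul_left_cancel₀ (hv₂ r).ne' (congrFun (Prod.ext_iff.1 heq).2 r))

lemma dominates_lineMap_one {v : IOVec m s} (hv : v ∈ rescalings m s) (hne : v ≠ 1) {t : ℝ}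
    (ht : t < 1) : Dominates v (AffineMap.lineMap 1 v t) := by
  refine ⟨?_, ?_, fun heq => ?_⟩
  · rw [AffineMap.fst_lineMap, right_le_lineMap_iff_le ht]
    exact hv.1.2
  · rw [AffineMap.snd_lineMap, lineMap_le_right_iff_le ht]
    exact hv.2
  · exact (AffineMap.lineMap_eq_right_iff.1 heq.symm).elim (fun h => hne h.symm) ht.ne

lemma strongMonotonicity_maxRGM (hS : IsClosed S) (hfd : FreelyDisposable S)
    (hb : HasBoundedOutputs S) (hws : weakFrontier S ⊆ strongFrontier S) :
    StrongMonotonicity (S ∩ ioOrthant m s) (maxRGM (S ∩ ioOrthant m s)) := by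
  intro p hp q hq hqp
  have hmaxp := isGreatest_maxRGM hS hfd hb hws hp
  obtain ⟨v, hv, hvp⟩ := hmaxp.1
  have hmax : IsMaxOn (fun v => russellObjective v.1 v.2) (efficientRescalings S p) v :=
    fun w hw => hvp.symm ▸ hmaxp.2 (mem_image_of_mem _ hw)
  have hθ := pos_of_isMaxOn_efficientRescalings hS hfd hb hp hv.1 hmax
  have hφ : ∀ r, 0 < v.2 r := fun r => zero_lt_one.trans_le (hv.1.2 r)
  have hvq : v * q ∉ S := (hws hv.2).2 _ (dominates_mul_mul hθ hφ hqp)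
  have hne : v ≠ 1 := by
    rintro rfl
    exact hvq (by simpa using hq.1)
  obtain ⟨t, ht, hmem⟩ := exists_lineMap_mem_weakFrontier hS hfd hq.1 hvq
  rw [← lineMap_one_mul] at hmem
  have hw : AffineMap.lineMap 1 v t ∈ rescalings m s :=
    convex_rescalings.lineMap_mem one_mem_rescalings hv.1 ⟨ht.1, ht.2.le⟩
  have hwq : AffineMap.lineMap 1 v t ∈ efficientRescalings S q := ⟨hw, hmem⟩
  rw [← hvp]
  exact (russellObjective_lt_of_dominates (dominates_lineMap_one hv.1 hne ht.2)
    fun r => zero_lt_one.trans_le (hw.2 r)).trans_le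
      ((isGreatest_maxRGM hS hfd hb hws hq).2 (mem_image_of_mem _ hwq))

end MaxRGM

theorem theorem2_general {m s : ℕ} {S : Set (IOVec m s)} (hS : IsClosed S)
    (hfd : FreelyDisposable S) (hb : HasBoundedOutputs S)
    (hws : weakFrontier S ⊆ strongFrontier S) :
    (∀ p ∈ S ∩ ioOrthant m s,
      IsGreatest (maxRGMValues (S ∩ ioOrthant m s) p) (maxRGM (S ∩ ioOrthant m s) p)) ∧
    Indication (S ∩ ioOrthant m s) (maxRGM (S ∩ ioOrthant m s)) ∧
    StrongMonotonicity (S ∩ ioOrthant m s) (maxRGM (S ∩ ioOrthant m s)) := by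
  refine ⟨fun p hp => ?_, indication_maxRGM hS hfd hb hws, strongMonotonicity_maxRGM hS hfd hb hws⟩
  rw [maxRGMValues_inter_ioOrthant hfd hws hp.2]
  exact isGreatest_maxRGM hS hfd hb hws hp

/-- The conclusion also records that the maximum defining the measure is attained on all of the
production set, so that its value is never a convention for an empty or unbounded set. -/
theorem theorem2 {m s n K : ℕ}
    (xd : Fin n → Fin m → ℝ) (yd : Fin n → Fin s → ℝ)
    (rin : Fin K → Fin m → ℝ) (rout : Fin K → Fin s → ℝ)
    (hxd : ∀ j, 0 ≤ xd j ∧ xd j ≠ 0)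
    (hyd : ∀ j, 0 ≤ yd j ∧ yd j ≠ 0)
    (hproper : tradeOffPolyhedron xd yd rin rout ≠ Set.univ)
    (hfrontier : strongFrontier (tradeOffPolyhedron xd yd rin rout) =
      weakFrontier (tradeOffPolyhedron xd yd rin rout)) :
    (∀ p ∈ productionSet xd yd rin rout,
      IsGreatest (maxRGMValues (productionSet xd yd rin rout) p)
        (maxRGM (productionSet xd yd rin rout) p)) ∧
    Indication (productionSet xd yd rin rout) (maxRGM (productionSet xd yd rin rout)) ∧
    StrongMonotonicity (productionSet xd yd rin rout)
      (maxRGM (productionSet xd yd rin rout)) :=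
  theorem2_general (isClosed_tradeOffPolyhedron ..) (freelyDisposable_tradeOffPolyhedron _ _ _ _)
    (hasBoundedOutputs_tradeOffPolyhedron _ _ _ _ hproper hfrontier.ge) hfrontier.ge
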